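/- All graphs are finite; patterns are simple undirected graphs, and $C_n$ is the cycle on $n\ge 3$ vertices. **Spasm.** $\mathrm{Spasm}(H)$ is the set of all graphs (up to isomorphism) obtained from $H$ by repeatedly (zero or more times) identifying two non-adjacent vertices and removing duplicated edges; equivalently, all $H'$ such that there is a homomorphism $H\to H'$ that is surjective on vertices and on edges. **Directed notions.** For a directed acyclic graph (DAG) $\vec H$, a *source* is a vertex without incoming arcs, and $S(\vec H)$ is the set of sources. For $S'\subseteq S(\vec H)$, $\mathrm{Reach}(S')$ is the set of vertices reachable from some element of $S'$ by a directed path (possibly of length $0$), and $\vec H(S')$ is the directed subgraph induced by $\mathrm{Reach}(S')$; write $\mathrm{Reach}(s)=\mathrm{Reach}(\{s\})$. The set $I(\vec H)$ of *intersection vertices* consists of the vertices reachable from at least two distinct sources. **DAG-treewidth.** A DAG-tree decomposition of $\vec H$ is a rooted tree $T$ whose nodes (bags) are subsets of $S(\vec H)$ with union $S(\vec H)$, such that $\mathrm{Reach}(B_1)\cap \mathrm{Reach}(B_2)\subseteq \mathrm{Reach}(B)$ whenever the bag $B$ lies on the path of $T$ between the bags $B_1$ and $B_2$. Its width is the maximum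 size of a bag, and the DAG-treewidth $\tau(\vec H)$ is the minimum width of a DAG-tree decomposition of $\vec H$. **Reducibility.** Let $k\ge 3$ and take indices modulo $k$. A connected DAG $\vec H$ is *$C_k$-reducible* if there are pairwise disjoint sets $S_1,\dots,S_k$ of sources with $\bigcup_i S_i=S(\vec H)$, sources $s_i\in S_i$, and sets $I_1,\dots,I_k\subseteq I(\vec H)$, with $I^*:=\bigcup_i I_i$, such that: - each $\vec H(S_i)$ has a DAG-tree decomposition of width $1$ whose root is the bag $\{s_i\}$; - for every vertex $u$, the sets $I_i$ containing $u$ form a cyclically continuous sequence: if $u\in I_i\cap I_j$, then $u$ lies in all of $I_i,I_{i+1},\dots,I_j$ or in all of $I_j,I_{j+1},\dots,I_i$; - for every $i$: $\mathrm{Reach}(S_i)\cap \mathrm{Reach}(S_{i+1})=I_i$; - for every $i$: $I_{i-1}\cup I_i=\mathrm{Reach}(S_i)\cap I^*$; - for all $i\ne j$: $\mathrm{Reach}(S_i)\cap \mathrm{Reach}(S_j)=\mathrm{Reach}(s_i)\cap \mathrm{Reach}(s_j)\subseteq I^*$. **Computability.** A pattern $H$ is *$C_k$-computable* if every acyclic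 orientation $\vec H$ of $H$ satisfies $\tau(\vec H)=1$ or is $C_l$-reducible for some $3\le l\le k$. **Lemma.** All patterns in $\mathrm{Spasm}(C_6)$ and in $\mathrm{Spasm}(C_7)$ are $C_3$-computable; all patterns in $\mathrm{Spasm}(C_8)$ and in $\mathrm{Spasm}(C_9)$ are $C_4$-computable; all patterns in $\mathrm{Spasm}(C_{10})$ are $C_5$-computable. -/

import Mathlib

namespace CyclePatterns

universe u v

variable {V : Type u} {W : Type v}

/-- `H'` belongs to the spasm of `H`: it is obtained (up to isomorphism) from `H` by identifying
vertices that are not adjacent and removing duplicated edges. Equivalently, there is a homomorphism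
`f` from `H` to `H'` that is surjective on vertices and on edges. -/
def InSpasm (H : SimpleGraph V) (H' : SimpleGraph W) : Prop :=
  ∃ f : H →g H', Function.Surjective f ∧
    ∀ a b : W, H'.Adj a b → ∃ x y : V, H.Adj x y ∧ f x = a ∧ f y = b

/-- A directed graph is acyclic if it has no directed closed walk of positive length
(in particular no loop and no pair of opposite arcs). -/
def IsAcyclic (D : Digraph V) : Prop :=
  ∀ x : V, ¬ Relation.TransGen D.Adj x x

/-- `D` is an acyclic orientation of the simple graph `H`. By acyclicity, each edge of `H` carries
exactly one of its two possible arcs. -/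
def IsAcyclicOrientation (H : SimpleGraph V) (D : Digraph V) : Prop :=
  IsAcyclic D ∧ D.toSimpleGraphInclusive = H

/-- The set `S(D)` of sources: the vertices without incoming arcs. -/
def sources (D : Digraph V) : Set V :=
  {x | ∀ y : V, ¬ D.Adj y x}

/-- `Reach_D(S)`: the vertices reachable from some element of `S` by a directed path, possibly of
length zero. -/
def reach (D : Digraph V) (S : Set V) : Set V :=
  {x | ∃ s ∈ S, Relation.ReflTransGen D.Adj s x}

/-- The set `I(D)` of intersection vertices: the vertices reachable from two distinct sources. -/
def intersectionVertices (D : Digraph V) : Set V :=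
  {x | ∃ s ∈ sources D, ∃ t ∈ sources D, s ≠ t ∧ x ∈ reach D {s} ∧ x ∈ reach D {t}}

/-- The directed subgraph of `D` induced by a set `A` of vertices. -/
def inducedDigraph (D : Digraph V) (A : Set V) : Digraph A where
  Adj x y := D.Adj x y

/-- `D(S)`: the directed subgraph of `D` induced by the vertices reachable from `S`. -/
def reachDigraph (D : Digraph V) (S : Set V) : Digraph (reach D S) :=
  inducedDigraph D (reach D S)

/-- A DAG-tree decomposition of `D`: a rooted tree whose nodes (bags) are sets of sources of `D`. -/
structure DagTreeDecomposition (D : Digraph V) where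
  /-- the nodes of the tree -/
  bags : Set (Set V)
  /-- the tree on the bags -/
  tree : SimpleGraph bags
  /-- the root -/
  root : bags
  isTree : tree.IsTree
  bags_subset : ∀ B ∈ bags, B ⊆ sources D
  cover : ⋃₀ bags = sources D
  reach_inter : ∀ (B B₁ B₂ : bags) (p : tree.Walk B₁ B₂), p.IsPath → B ∈ p.support →
    reach D B₁ ∩ reach D B₂ ⊆ reach D B

/-- The width of a decomposition: the maximum size of its bags (for a finite graph). -/
noncomputable def DagTreeDecomposition.width {D : Digraph V} (T : DagTreeDecomposition D) : ℕ :=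
  sSup (Set.ncard '' T.bags)

/-- The DAG-treewidth `τ(D)` of a finite directed acyclic graph: the minimum width of its
DAG-tree decompositions. -/
noncomputable def dagTreewidth (D : Digraph V) : ℕ :=
  sInf (Set.range (DagTreeDecomposition.width (D := D)))

/-- The subsets `I i`, indexed cyclically, that contain a given vertex `x` are cyclically
consecutive: if `I i` and `I j` contain `x`, then so do all the sets met when going forward from
`i` to `j`, or all the sets met when going forward from `j` to `i`. -/
def IsCyclicallyContinuous {k : ℕ} (I : ZMod k → Set V) : Prop :=
  ∀ (x : V) (i j : ZMod k), x ∈ I i → x ∈ I j →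
    (∀ t : ℕ, t ≤ (j - i).val → x ∈ I (i + t)) ∨ (∀ t : ℕ, t ≤ (i - j).val → x ∈ I (j + t))

/-- A witness that `D` reduces to the cycle of length `k`: source sets `S i` with distinguished
sources `s i`, and intersection sets `I i`, where the indices are taken modulo `k`. Below, the
vertex set of `D(S i)` is `reach D (S i)`, and the set `I*` is `⋃ m, I m`. -/
structure CycleReduction (k : ℕ) (D : Digraph V) where
  /-- the source sets -/
  S : ZMod k → Set V
  /-- the intersection sets -/
  I : ZMod k → Set V
  /-- the distinguished sources -/
  s : ZMod k → V
  S_subset : ∀ i, S i ⊆ sources D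
  S_disjoint : ∀ i j, i ≠ j → Disjoint (S i) (S j)
  S_cover : ⋃ i, S i = sources D
  s_mem : ∀ i, s i ∈ S i
  /-- each `D(S i)` has a DAG-tree decomposition of width `1` rooted at the bag `{s i}` -/
  decomposition : ∀ i, ∃ T : DagTreeDecomposition (reachDigraph D (S i)),
    T.width = 1 ∧ Subtype.val '' (T.root : Set (reach D (S i))) = {s i}
  I_subset : ∀ i, I i ⊆ intersectionVertices D
  I_continuous : IsCyclicallyContinuous I
  inter_succ : ∀ i, reach D (S i) ∩ reach D (S (i + 1)) = I i
  union_pred : ∀ i, I (i - 1) ∪ I i = reach D (S i) ∩ ⋃ m, I m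
  inter_eq : ∀ i j, j ≠ i →
    reach D (S i) ∩ reach D (S j) = reach D {s i} ∩ reach D {s j}
  inter_subset : ∀ i j, j ≠ i → reach D (S i) ∩ reach D (S j) ⊆ ⋃ m, I m

/-- `D` is a connected DAG that is reducible to the cycle of length `k ≥ 3`. -/
def IsCycleReducible (k : ℕ) (D : Digraph V) : Prop :=
  3 ≤ k ∧ IsAcyclic D ∧ D.toSimpleGraphInclusive.Connected ∧ Nonempty (CycleReduction k D)

/-- The pattern `H` is computable through the cycle of length `k`: each of its acyclic orientations
has DAG-treewidth `1` or is reducible to the cycle of length `l` for some `l ≤ k`. -/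
def IsCycleComputable (k : ℕ) (H : SimpleGraph V) : Prop :=
  ∀ D : Digraph V, IsAcyclicOrientation H D →
    dagTreewidth D = 1 ∨ ∃ l : ℕ, l ≤ k ∧ IsCycleReducible l D

end CyclePatterns

/-!
Let `D` be an acyclic orientation of a quotient of the cycle of length `n`. The cycle becomes a
closed walk through all arcs of `D`, and since sources are pairwise non-adjacent, `D` has at most
`n / 2` of them. For each vertex only the set of sources reaching it matters, and reducibility
becomes a statement about the family of these sets (`isCycleReducible_of_dominated`): if the sources
have a cyclic order in which each set with at least two elements contains, with each of its
elements, a cyclic neighbour of this element, then `D` reduces to a cycle through all sources;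
moreover, a source that meets the rest of the graph only within the reach of another source can
first be absorbed into the source set of the latter.

One or two sources give DAG-treewidth one. Three sources always form a cycle of length three, as any
two of three residues are cyclic neighbours. This settles `n < 8`. Five sources with `n = 10` force
the walk to alternate between sources and other vertices, so the cyclic order of the walk works.

The essential case is that of four sources with `n ≤ 10`, where a walk with `n < 10` is extended to
length ten by pauses. A cyclic order of four sources works unless some vertex is reached exactly
from the two ends of a diagonal. Up to rotation, the sources cut the walk into segments of lengths
`4, 2, 2, 2`, or `3, 3, 2, 2`, or `3, 2, 3, 2`. If a vertex is reached by exactly two sources, then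
each of them alone reaches some vertex next to a vertex reached by exactly these two, because the
set of sources changes only along arcs (`IsLabelling.entry_pair`). This pins down the walk so far
that whenever a diagonal of the order of the walk occurs, either one source is dominated by another
one, which gives a cycle of length three, or another cyclic order has no occurring diagonal, which
gives a cycle of length four (`IsLabelling.cases_four_two_two_two`,
`IsLabelling.cases_three_three_two_two`, `IsLabelling.cases_three_two_three_two`).
-/

namespace CyclePatterns

universe u v

variable {V : Type u} {W : Type v}

/-! ### Reachability from sources -/

/-- There is a directed path, possibly of length zero, from `x` to `y`. -/
abbrev Reaches (D : Digraph V) (x y : V) : Prop := Relation.ReflTransGen D.Adj x y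

@[simp]
theorem mem_reach_singleton {D : Digraph V} {a x : V} : x ∈ reach D {a} ↔ Reaches D a x := by
  simp [reach]

@[simp]
theorem mem_reach_pair {D : Digraph V} {a b x : V} :
    x ∈ reach D {a, b} ↔ Reaches D a x ∨ Reaches D b x := by
  simp [reach]

theorem Reaches.eq_of_mem_sources {D : Digraph V} {a x : V} (h : Reaches D a x)
    (hx : x ∈ sources D) : a = x := by
  rcases Relation.ReflTransGen.cases_tail h with h | ⟨y, -, hy⟩
  · exact h.symm
  · exact absurd hy (hx y)

theorem IsAcyclic.exists_source_reaches [Finite V] {D : Digraph V} (hD : IsAcyclic D) (v : V) :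
    ∃ a ∈ sources D, Reaches D a v := by
  have : Std.Irrefl (Relation.TransGen D.Adj) := ⟨hD⟩
  have wf := Finite.wellFounded_of_trans_of_irrefl (Relation.TransGen D.Adj)
  induction v using wf.induction with
  | _ v ih =>
    by_cases hv : v ∈ sources D
    · exact ⟨v, hv, .refl⟩
    · obtain ⟨y, hy⟩ : ∃ y, D.Adj y v := by
        by_contra! h
        exact hv h
      obtain ⟨a, ha, hay⟩ := ih y (.single hy)
      exact ⟨a, ha, hay.tail hy⟩

theorem sources_reachDigraph {D : Digraph V} {S : Set V} (hS : S ⊆ sources D) :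
    sources (reachDigraph D S) = Subtype.val ⁻¹' S := by
  ext ⟨x, s, hs, hsx⟩
  constructor
  · intro h
    rcases Relation.ReflTransGen.cases_tail hsx with h' | ⟨y, hsy, hyx⟩
    · subst h'
      exact hs
    · exact absurd hyx (h ⟨y, s, hs, hsy⟩)
  · intro h y hy
    exact hS h _ hy

/-! ### Decompositions of width one -/

/-- The two bags `{a}` and `{b}` need not be distinct, so this also covers a single source. A path
between two of at most two bags meets no third bag, so the condition on intersections is void. -/
theorem exists_decomposition_of_sources_eq_pair (D : Digraph V) {a b : V}
    (h : sources D = {a, b}) :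
    ∃ T : DagTreeDecomposition D, T.width = 1 ∧ (T.root : Set V) = {a} := by
  let bags : Set (Set V) := {{a}, {b}}
  have htwo : ∀ B C E : bags, B = C ∨ B = E ∨ C = E := by
    rintro ⟨B, rfl | rfl⟩ ⟨C, rfl | rfl⟩ ⟨E, rfl | rfl⟩ <;> simp
  have hroot : ({a} : Set V) ∈ bags := Or.inl rfl
  have : Nonempty bags := ⟨⟨_, hroot⟩⟩
  have htree : (⊤ : SimpleGraph bags).IsTree := by
    refine ⟨SimpleGraph.connected_top, fun v c hc => ?_⟩
    have hfin : bags.Finite := Set.toFinite _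
    have : Fintype bags := hfin.fintype
    have h1 := hc.support_nodup.length_le_card
    have h2 : Fintype.card bags ≤ 2 := by
      rw [← Nat.card_eq_fintype_card, Nat.card_coe_set_eq]
      exact (Set.ncard_insert_le _ _).trans (by simp)
    have h3 := hc.three_le_length
    rw [List.length_tail, SimpleGraph.Walk.length_support] at h1
    omega
  refine ⟨⟨bags, ⊤, ⟨{a}, hroot⟩, htree, ?_, ?_, ?_⟩, ?_, rfl⟩
  · rintro B (rfl | rfl) <;> simp [h]
  · rw [h, Set.sUnion_pair]
    rfl
  · intro B B₁ B₂ p hp hB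
    rcases htwo B B₁ B₂ with rfl | rfl | rfl
    · exact Set.inter_subset_left
    · exact Set.inter_subset_right
    · rw [SimpleGraph.Walk.nil_iff_support_eq.1 (SimpleGraph.Walk.isPath_iff_nil.1 hp),
        List.mem_singleton] at hB
      rw [hB, Set.inter_self]
  · simp [DagTreeDecomposition.width, bags, Set.image_pair]

theorem dagTreewidth_eq_one_of_sources_eq_pair [Finite V] (D : Digraph V) {a b : V}
    (h : sources D = {a, b}) : dagTreewidth D = 1 := by
  obtain ⟨T, hT, -⟩ := exists_decomposition_of_sources_eq_pair D h
  refine le_antisymm (Nat.sInf_le ⟨T, hT⟩) ?_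
  obtain ⟨T', hT'⟩ := Nat.sInf_mem (Set.range_nonempty_iff_nonempty.2 ⟨T⟩)
  rw [dagTreewidth, ← hT', DagTreeDecomposition.width]
  have ha : a ∈ ⋃₀ T'.bags := by rw [T'.cover, h]; exact Or.inl rfl
  obtain ⟨B, hB, haB⟩ := ha
  refine le_trans ?_ (le_csSup (Set.toFinite _).bddAbove ⟨B, hB, rfl⟩)
  exact Nat.succ_le_of_lt ((Set.ncard_pos).2 ⟨a, haB⟩)

/-! ### A criterion for reducibility to a cycle -/

/-- A set of residues, if it has at least two elements, contains a cyclic neighbour of each of its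
elements. -/
def NoIsolated {k : ℕ} (A : Set (ZMod k)) : Prop :=
  ∀ i ∈ A, ∀ j ∈ A, j ≠ i → i - 1 ∈ A ∨ i + 1 ∈ A

/-- The elements `i` of `A` with `i + 1 ∈ A` form a cyclic interval. -/
def HasConsecutiveSteps {k : ℕ} (A : Set (ZMod k)) : Prop :=
  ∀ i ∈ A, ∀ j ∈ A, i + 1 ∈ A → j + 1 ∈ A →
    (∀ t ≤ (j - i).val, i + (t : ZMod k) ∈ A ∧ i + (t : ZMod k) + 1 ∈ A) ∨
    (∀ t ≤ (i - j).val, j + (t : ZMod k) ∈ A ∧ j + (t : ZMod k) + 1 ∈ A)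

set_option synthInstance.maxSize 1000 in
/-- A set without isolated points in a cycle of length at most five is a cyclic interval: two
separated intervals of length two would need six points. -/
theorem NoIsolated.hasConsecutiveSteps {k : ℕ} (hk : 3 ≤ k) (hk' : k ≤ 5) {A : Set (ZMod k)}
    (hA : NoIsolated A) : HasConsecutiveSteps A := by
  have key3 : ∀ A : Finset (ZMod 3), NoIsolated (A : Set (ZMod 3)) →
      HasConsecutiveSteps (A : Set (ZMod 3)) := by
    simp only [NoIsolated, HasConsecutiveSteps, Finset.mem_coe]
    decide +kernel
  have key4 : ∀ A : Finset (ZMod 4), NoIsolated (A : Set (ZMod 4)) →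
      HasConsecutiveSteps (A : Set (ZMod 4)) := by
    simp only [NoIsolated, HasConsecutiveSteps, Finset.mem_coe]
    decide +kernel
  have key5 : ∀ A : Finset (ZMod 5), NoIsolated (A : Set (ZMod 5)) →
      HasConsecutiveSteps (A : Set (ZMod 5)) := by
    simp only [NoIsolated, HasConsecutiveSteps, Finset.mem_coe]
    decide +kernel
  classical
  have : NeZero k := ⟨by omega⟩
  obtain ⟨F, rfl⟩ : ∃ F : Finset (ZMod k), A = F := ⟨A.toFinset, by simp⟩
  interval_cases k
  · exact key3 F hA
  · exact key4 F hA
  · exact key5 F hA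

/-- Reducibility to a cycle when every source set is `{s i, e i}`, where `e i` may coincide with
`s i` and otherwise meets the rest of the graph only within the reach of `s i`. The intersection
sets are then the sets `Reach (s i) ∩ Reach (s (i + 1))`. -/
theorem isCycleReducible_of_dominated {k : ℕ} (hk : 3 ≤ k) (hk' : k ≤ 5) {D : Digraph V}
    (hD : IsAcyclic D) (hconn : D.toSimpleGraphInclusive.Connected) (s e : ZMod k → V)
    (hsrc : ∀ x, x ∈ sources D ↔ ∃ i, x = s i ∨ x = e i)
    (hinj : ∀ i j, i ≠ j → s i ≠ s j ∧ s i ≠ e j ∧ e i ≠ e j)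
    (hdom : ∀ i j v, j ≠ i → Reaches D (e i) v → Reaches D (s j) v ∨ Reaches D (e j) v →
      Reaches D (s i) v)
    (hiso : ∀ v, NoIsolated {i | Reaches D (s i) v}) : IsCycleReducible k D := by
  have hs : ∀ i, s i ∈ sources D := fun i => (hsrc _).2 ⟨i, .inl rfl⟩
  have he : ∀ i, e i ∈ sources D := fun i => (hsrc _).2 ⟨i, .inr rfl⟩
  have : Fact (1 < k) := ⟨by omega⟩
  have hsucc : ∀ i : ZMod k, i + 1 ≠ i := fun i h => one_ne_zero (left_eq_add.1 h.symm)
  have hinter : ∀ i j, j ≠ i → reach D {s i, e i} ∩ reach D {s j, e j} =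
      reach D {s i} ∩ reach D {s j} := by
    intro i j hij
    ext v
    simp only [Set.mem_inter_iff, mem_reach_pair, mem_reach_singleton]
    constructor
    · rintro ⟨hi, hj⟩
      exact ⟨hi.elim id fun h => hdom i j v hij h hj,
        hj.elim id fun h => hdom j i v hij.symm h hi⟩
    · exact fun h => ⟨.inl h.1, .inl h.2⟩
  -- A vertex reached from two source sets lies in an intersection set next to either of them.
  have hnext : ∀ i j v, j ≠ i → Reaches D (s i) v → Reaches D (s j) v →
      v ∈ reach D {s (i - 1)} ∩ reach D {s i} ∨ v ∈ reach D {s i} ∩ reach D {s (i + 1)} := by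
    intro i j v hij hi hj
    simp only [Set.mem_inter_iff, mem_reach_singleton]
    exact (hiso v i hi j hj hij).imp (fun h => ⟨h, hi⟩) (fun h => ⟨hi, h⟩)
  refine ⟨hk, hD, hconn, ⟨{
    S := fun i => {s i, e i}
    I := fun i => reach D {s i} ∩ reach D {s (i + 1)}
    s := s
    S_subset := ?_
    S_disjoint := ?_
    S_cover := ?_
    s_mem := fun i => Or.inl rfl
    decomposition := ?_
    I_subset := ?_
    I_continuous := ?_
    inter_succ := fun i => hinter i (i + 1) (hsucc i)
    union_pred := ?_
    inter_eq := hinter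
    inter_subset := ?_ }⟩⟩
  · rintro i x (rfl | rfl)
    exacts [hs i, he i]
  · intro i j hij
    rw [Set.disjoint_left]
    rintro x (rfl | rfl) (h | h)
    exacts [(hinj i j hij).1 h, (hinj i j hij).2.1 h, (hinj j i hij.symm).2.1 h.symm,
      (hinj i j hij).2.2 h]
  · ext x
    simp [hsrc]
  · intro i
    have hsub : ({s i, e i} : Set V) ⊆ sources D := by
      rintro x (rfl | rfl)
      exacts [hs i, he i]
    let a : reach D {s i, e i} := ⟨s i, s i, .inl rfl, .refl⟩
    let b : reach D {s i, e i} := ⟨e i, e i, .inr rfl, .refl⟩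
    have hab : sources (reachDigraph D {s i, e i}) = {a, b} := by
      rw [sources_reachDigraph hsub]
      ext x
      simp [a, b, Subtype.ext_iff]
    obtain ⟨T, hT, hroot⟩ := exists_decomposition_of_sources_eq_pair _ hab
    exact ⟨T, hT, by rw [hroot]; simp [a]⟩
  · rintro i x ⟨h₁, h₂⟩
    exact ⟨s i, hs i, s (i + 1), hs _, (hinj _ _ (hsucc i).symm).1, h₁, h₂⟩
  · intro x i j hi hj
    simp only [Set.mem_inter_iff, mem_reach_singleton] at hi hj ⊢
    exact (hiso x).hasConsecutiveSteps hk hk' i hi.1 j hj.1 hi.2 hj.2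
  · intro i
    ext v
    simp only [sub_add_cancel]
    constructor
    · rintro (h | h)
      · refine ⟨mem_reach_pair.2 (.inl (mem_reach_singleton.1 h.2)), Set.mem_iUnion.2 ⟨i - 1, ?_⟩⟩
        simpa using h
      · exact ⟨mem_reach_pair.2 (.inl (mem_reach_singleton.1 h.1)), Set.mem_iUnion.2 ⟨i, h⟩⟩
    · rintro ⟨hi, hv⟩
      obtain ⟨m, hm⟩ := Set.mem_iUnion.1 hv
      simp only [Set.mem_inter_iff, mem_reach_singleton] at hm
      rw [mem_reach_pair] at hi
      obtain ⟨j, hj, hjv⟩ : ∃ j, j ≠ i ∧ Reaches D (s j) v := by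
        by_cases h : m = i
        · exact ⟨m + 1, h ▸ hsucc m, hm.2⟩
        · exact ⟨m, h, hm.1⟩
      exact hnext i j v hj (hi.elim id fun h => hdom i j v hj h (.inl hjv)) hjv
  · intro i j hij v hv
    rw [hinter i j hij] at hv
    simp only [Set.mem_inter_iff, mem_reach_singleton] at hv
    rcases hnext i j v hij hv.1 hv.2 with h | h
    · exact Set.mem_iUnion.2 ⟨i - 1, by simpa using h⟩
    · exact Set.mem_iUnion.2 ⟨i, h⟩

/-- Three sources always form a cycle of length three: any two of three residues are cyclic
neighbours. The third source `c` may come with a source `d` that it dominates. -/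
theorem isCycleReducible_three {D : Digraph V}
    (hD : IsAcyclic D) (hconn : D.toSimpleGraphInclusive.Connected) {a b c d : V}
    (hsrc : sources D = {a, b, c, d}) (hab : a ≠ b) (hac : a ≠ c) (hbc : b ≠ c) (had : a ≠ d)
    (hbd : b ≠ d)
    (hdom : ∀ v, Reaches D d v → Reaches D a v ∨ Reaches D b v → Reaches D c v) :
    IsCycleReducible 3 D := by
  have h3 : ∀ i : ZMod 3, i = 0 ∨ i = 1 ∨ i = 2 := by decide
  refine isCycleReducible_of_dominated le_rfl (by norm_num) hD hconn ![a, b, c] ![a, b, d]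
    ?_ ?_ ?_ ?_
  · intro x
    rw [hsrc]
    change _ ↔ ∃ i : Fin 3, _
    simp [Fin.exists_fin_succ]
  · intro i j hij
    rcases h3 i with rfl | rfl | rfl <;> rcases h3 j with rfl | rfl | rfl <;>
      first
      | exact absurd rfl hij
      | exact ⟨by assumption, by assumption, by assumption⟩
      | exact ⟨Ne.symm (by assumption), Ne.symm (by assumption), Ne.symm (by assumption)⟩
  · intro i j v hij hi hj
    rcases h3 i with rfl | rfl | rfl
    · exact hi
    · exact hi
    · rcases h3 j with rfl | rfl | rfl
      · exact hdom v hi (.inl (hj.elim id id))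
      · exact hdom v hi (.inr (hj.elim id id))
      · exact absurd rfl hij
  · intro v i hi j hj hij
    have : ∀ i j : ZMod 3, j ≠ i → j = i - 1 ∨ j = i + 1 := by decide
    rcases this i j hij with rfl | rfl
    exacts [.inl hj, .inr hj]

/-- Four sources in cyclic order form a cycle of length four unless some vertex is reached from
exactly the two ends of a diagonal. -/
theorem isCycleReducible_four {D : Digraph V}
    (hD : IsAcyclic D) (hconn : D.toSimpleGraphInclusive.Connected) {s : Fin 4 → V}
    (hs : Function.Injective s) (hsrc : sources D = Set.range s)
    (h02 : ∀ v, {i | Reaches D (s i) v} ≠ {0, 2}) (h13 : ∀ v, {i | Reaches D (s i) v} ≠ {1, 3}) :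
    IsCycleReducible 4 D := by
  refine isCycleReducible_of_dominated (by norm_num) (by norm_num) hD hconn s s ?_ ?_ ?_ ?_
  · intro x
    rw [hsrc]
    simp [eq_comm]
    rfl
  · intro i j hij
    exact ⟨hs.ne hij, hs.ne hij, hs.ne hij⟩
  · exact fun _ _ _ _ h _ => h
  · intro v
    have key : ∀ A : Finset (ZMod 4), A ≠ {0, 2} → A ≠ {1, 3} →
        NoIsolated (A : Set (ZMod 4)) := by
      simp only [NoIsolated, Finset.mem_coe]; decide
    classical
    obtain ⟨F, hF⟩ : ∃ F : Finset (ZMod 4), {i : ZMod 4 | Reaches D (s i) v} = F :=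
      ⟨{i : ZMod 4 | Reaches D (s i) v}.toFinset, by simp⟩
    rw [hF]
    refine key F ?_ ?_
    · rintro rfl
      exact h02 v (hF.trans (by simp; rfl))
    · rintro rfl
      exact h13 v (hF.trans (by simp; rfl))

/-! ### Labellings of a closed walk of length ten -/

/-- The properties of the map that assigns to each position of a closed walk of length ten,
covering all arcs of a directed acyclic graph, the set of those of its four sources that reach the
vertex at this position. The field `entry` says that a source reaching a vertex together with
others does so through an arc at which the paths from this source first meet those from others. -/
structure IsLabelling (L : Fin 10 → Set (Fin 4)) : Prop where
  nonempty : ∀ i, (L i).Nonempty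
  comparable : ∀ i, L i ⊆ L (i + 1) ∨ L (i + 1) ⊆ L i
  entry : ∀ i, ∀ x ∈ L i, L i ≠ {x} →
    ∃ j, (L j = {x} ∧ x ∈ L (j + 1) ∧ L (j + 1) ≠ {x} ∧ L (j + 1) ⊆ L i) ∨
      (L (j + 1) = {x} ∧ x ∈ L j ∧ L j ≠ {x} ∧ L j ⊆ L i)

namespace IsLabelling

variable {L : Fin 10 → Set (Fin 4)}

theorem mem_succ (hL : IsLabelling L) {i : Fin 10} {x : Fin 4} (h : L i = {x}) : x ∈ L (i + 1) := by
  rcases hL.comparable i with h' | h'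
  · exact h' (h ▸ rfl)
  · rw [h, Set.subset_singleton_iff_eq] at h'
    rcases h' with h' | h'
    · exact absurd h' (hL.nonempty _).ne_empty
    · exact h' ▸ rfl

theorem mem_pred (hL : IsLabelling L) {i : Fin 10} {x : Fin 4} (h : L (i + 1) = {x}) : x ∈ L i := by
  rcases hL.comparable i with h' | h'
  · rw [h, Set.subset_singleton_iff_eq] at h'
    rcases h' with h' | h'
    · exact absurd h' (hL.nonempty _).ne_empty
    · exact h' ▸ rfl
  · exact h' (h ▸ rfl)

/-- A label with two elements occurs next to the label that consists of one of them. -/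
theorem entry_pair (hL : IsLabelling L) {i : Fin 10} {x y : Fin 4} (hxy : x ≠ y) (h : L i = {x, y}) :
    ∃ j, (L j = {x} ∧ L (j + 1) = {x, y}) ∨ (L (j + 1) = {x} ∧ L j = {x, y}) := by
  have key : ∀ A : Set (Fin 4), x ∈ A → A ≠ {x} → A ⊆ L i → A = {x, y} := by
    intro A hx hne hA
    rw [h, Set.subset_pair_iff_eq] at hA
    rcases hA with rfl | rfl | rfl | rfl
    · exact absurd hx (by simp)
    · exact absurd rfl hne
    · exact absurd hx hxy
    · rfl
  obtain ⟨j, ⟨h₁, h₂, h₃, h₄⟩ | ⟨h₁, h₂, h₃, h₄⟩⟩ := hL.entry i x (by simp [h])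
    (fun h' => hxy (Set.mem_singleton_iff.1
      (h' ▸ h ▸ Set.mem_insert_of_mem x rfl : y ∈ ({x} : Set (Fin 4)))).symm)
  · exact ⟨j, .inl ⟨h₁, key _ h₂ h₃ h₄⟩⟩
  · exact ⟨j, .inr ⟨h₁, key _ h₂ h₃ h₄⟩⟩

/-- If `y` occurs in every label next to a label `{x}` that contains `x` together with other sources,
then `y` dominates `x`. -/
theorem mem_of_mem (hL : IsLabelling L) {x y : Fin 4}
    (h : ∀ j, (L j = {x} → L (j + 1) = {x} ∨ y ∈ L (j + 1)) ∧
      (L (j + 1) = {x} → L j = {x} ∨ y ∈ L j))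
    (i : Fin 10) (hx : x ∈ L i) (hi : L i ≠ {x}) : y ∈ L i := by
  obtain ⟨j, ⟨h₁, h₂, h₃, h₄⟩ | ⟨h₁, h₂, h₃, h₄⟩⟩ := hL.entry i x hx hi
  · exact h₄ (((h j).1 h₁).resolve_left h₃)
  · exact h₄ (((h j).2 h₁).resolve_left h₃)

/-- The sources in cyclic order cut the closed walk into segments of lengths `4`, `2`, `2`, `2`.
A diagonal can only be entered within the long segment, next to a vertex that only the other source
of the diagonal reaches; then the source at one end of this segment is dominated. -/
theorem cases_four_two_two_two (hL : IsLabelling L) (h0 : L 0 = {0}) (h4 : L 4 = {1})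
    (h6 : L 6 = {2}) (h8 : L 8 = {3}) :
    ((∀ i, L i ≠ {0, 2}) ∧ ∀ i, L i ≠ {1, 3}) ∨
      ∃ x y, x ≠ y ∧ ∀ i, x ∈ L i → L i ≠ {x} → y ∈ L i := by
  have h10 : 0 ∈ L 1 := hL.mem_succ h0
  have h90 : 0 ∈ L 9 := hL.mem_pred (i := 9) h0
  have h31 : 1 ∈ L 3 := hL.mem_pred (i := 3) h4
  have h51 : 1 ∈ L 5 := hL.mem_succ h4
  have h52 : 2 ∈ L 5 := hL.mem_pred (i := 5) h6
  have h72 : 2 ∈ L 7 := hL.mem_succ h6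
  have h73 : 3 ∈ L 7 := hL.mem_pred (i := 7) h8
  have h93 : 3 ∈ L 9 := hL.mem_succ h8
  by_cases h02 : ∃ i, L i = {0, 2}
  · obtain ⟨i, hi⟩ := h02
    obtain ⟨j, hj⟩ := hL.entry_pair (by decide) (hi.trans (Set.pair_comm _ _))
    -- The entry of the source `2` into the label `{0, 2}` can only be at position `1`, coming
    -- from position `2`.
    obtain ⟨h1, h2⟩ : L 1 = {0, 2} ∧ L 2 = {2} := by
      fin_cases j <;> simp at hj <;> grind
    have h32 : 2 ∈ L 3 := hL.mem_succ h2
    refine .inr ⟨1, 2, by decide, hL.mem_of_mem fun j => ?_⟩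
    fin_cases j <;> simp [h0, h4, h6, h8] <;> grind
  by_cases h13 : ∃ i, L i = {1, 3}
  · obtain ⟨i, hi⟩ := h13
    obtain ⟨j, hj⟩ := hL.entry_pair (by decide) (hi.trans (Set.pair_comm _ _))
    obtain ⟨h3, h2⟩ : L 3 = {1, 3} ∧ L 2 = {3} := by
      fin_cases j <;> simp at hj <;> grind
    have h13 : 3 ∈ L 1 := hL.mem_pred (i := 1) h2
    refine .inr ⟨0, 3, by decide, hL.mem_of_mem fun j => ?_⟩
    fin_cases j <;> simp [h0, h4, h6, h8] <;> grind
  · exact .inl ⟨not_exists.1 h02, not_exists.1 h13⟩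

/-- The sources in cyclic order cut the closed walk into segments of lengths `3`, `3`, `2`, `2`.
Only the diagonal of the two outer ends of the long segments can occur, and it then occurs within
both of them, so that the source between them is dominated. -/
theorem cases_three_three_two_two (hL : IsLabelling L) (h0 : L 0 = {0}) (h3 : L 3 = {1})
    (h6 : L 6 = {2}) (h8 : L 8 = {3}) :
    ((∀ i, L i ≠ {0, 2}) ∧ ∀ i, L i ≠ {1, 3}) ∨
      ∃ x y, x ≠ y ∧ ∀ i, x ∈ L i → L i ≠ {x} → y ∈ L i := by
  have h10 : 0 ∈ L 1 := hL.mem_succ h0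
  have h90 : 0 ∈ L 9 := hL.mem_pred (i := 9) h0
  have h21 : 1 ∈ L 2 := hL.mem_pred (i := 2) h3
  have h41 : 1 ∈ L 4 := hL.mem_succ h3
  have h52 : 2 ∈ L 5 := hL.mem_pred (i := 5) h6
  have h72 : 2 ∈ L 7 := hL.mem_succ h6
  have h73 : 3 ∈ L 7 := hL.mem_pred (i := 7) h8
  have h93 : 3 ∈ L 9 := hL.mem_succ h8
  have h13 : ∀ i, L i ≠ {1, 3} := by
    intro i hi
    obtain ⟨j, hj⟩ := hL.entry_pair (by decide) (hi.trans (Set.pair_comm _ _))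
    fin_cases j <;> simp at hj <;> grind
  by_cases h02 : ∃ i, L i = {0, 2}
  · obtain ⟨i, hi⟩ := h02
    obtain ⟨j, hj⟩ := hL.entry_pair (by decide) hi
    have h1 : L 1 = {0, 2} := by
      fin_cases j <;> simp at hj <;> grind
    obtain ⟨k, hk⟩ := hL.entry_pair (by decide) (hi.trans (Set.pair_comm _ _))
    have h5 : L 5 = {0, 2} := by
      fin_cases k <;> simp at hk <;> grind
    have h20 : 0 ∈ L 2 := (hL.comparable 1).elim (fun h => h (h1 ▸ Or.inl rfl))
      fun h => absurd (h h21) (by simp [h1])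
    have h40 : 0 ∈ L 4 := (hL.comparable 4).elim (fun h => absurd (h h41) (by simp [h5]))
      fun h => h (h5 ▸ Or.inl rfl)
    refine .inr ⟨1, 0, by decide, hL.mem_of_mem fun j => ?_⟩
    fin_cases j <;> simp [h0, h3, h6, h8] <;> grind
  · exact .inl ⟨not_exists.1 h02, h13⟩

/-- The sources in cyclic order cut the closed walk into segments of lengths `3`, `2`, `3`, `2`. If
a diagonal of the cyclic order `0, 1, 2, 3` occurs as a label, then none of the order `1, 2, 0, 3`
does. -/
theorem cases_three_two_three_two (hL : IsLabelling L) (h0 : L 0 = {0}) (h3 : L 3 = {1})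
    (h5 : L 5 = {2}) (h8 : L 8 = {3}) :
    ((∀ i, L i ≠ {0, 2}) ∧ ∀ i, L i ≠ {1, 3}) ∨ ((∀ i, L i ≠ {0, 1}) ∧ ∀ i, L i ≠ {2, 3}) := by
  have h10 : 0 ∈ L 1 := hL.mem_succ h0
  have h90 : 0 ∈ L 9 := hL.mem_pred (i := 9) h0
  have h21 : 1 ∈ L 2 := hL.mem_pred (i := 2) h3
  have h41 : 1 ∈ L 4 := hL.mem_succ h3
  have h42 : 2 ∈ L 4 := hL.mem_pred (i := 4) h5
  have h62 : 2 ∈ L 6 := hL.mem_succ h5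
  have h73 : 3 ∈ L 7 := hL.mem_pred (i := 7) h8
  have h93 : 3 ∈ L 9 := hL.mem_succ h8
  by_cases h02 : ∃ i, L i = {0, 2}
  · obtain ⟨i, hi⟩ := h02
    obtain ⟨j, hj⟩ := hL.entry_pair (by decide) hi
    have h1 : L 1 = {0, 2} := by
      fin_cases j <;> simp at hj <;> grind
    obtain ⟨k, hk⟩ := hL.entry_pair (by decide) (hi.trans (Set.pair_comm _ _))
    have h6 : L 6 = {0, 2} := by
      fin_cases k <;> simp at hk <;> grind
    have h2 : L 1 ⊆ L 2 := (hL.comparable 1).resolve_right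
      fun h => absurd (h h21) (by simp [h1])
    have h7 : L 6 ⊆ L 7 := (hL.comparable 6).resolve_right
      fun h => absurd (h h73) (by simp [h6])
    have h22 : 2 ∈ L 2 := h2 (by simp [h1])
    have h70 : 0 ∈ L 7 := h7 (by simp [h6])
    clear hj hk hi
    refine .inr ⟨fun i hi => ?_, fun i hi => ?_⟩
    · have h : 0 ∈ L i ∧ 1 ∈ L i ∧ 2 ∉ L i ∧ 3 ∉ L i := by simp [hi]
      clear hi
      fin_cases i <;> simp_all
    · have h : 2 ∈ L i ∧ 3 ∈ L i ∧ 0 ∉ L i ∧ 1 ∉ L i := by simp [hi]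
      clear hi
      fin_cases i <;> simp_all
  by_cases h13 : ∃ i, L i = {1, 3}
  · obtain ⟨i, hi⟩ := h13
    obtain ⟨j, hj⟩ := hL.entry_pair (by decide) hi
    have h2 : L 2 = {1, 3} := by
      fin_cases j <;> simp at hj <;> grind
    obtain ⟨k, hk⟩ := hL.entry_pair (by decide) (hi.trans (Set.pair_comm _ _))
    have h7 : L 7 = {1, 3} := by
      fin_cases k <;> simp at hk <;> grind
    have h1 : L 2 ⊆ L 1 := (hL.comparable 1).resolve_left
      fun h => absurd (h h10) (by simp [h2])
    have h6 : L 7 ⊆ L 6 := (hL.comparable 6).resolve_left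
      fun h => absurd (h h62) (by simp [h7])
    have h13 : 3 ∈ L 1 := h1 (by simp [h2])
    have h61 : 1 ∈ L 6 := h6 (by simp [h7])
    clear hj hk hi
    refine .inr ⟨fun i hi => ?_, fun i hi => ?_⟩
    · have h : 0 ∈ L i ∧ 1 ∈ L i ∧ 2 ∉ L i ∧ 3 ∉ L i := by simp [hi]
      clear hi
      fin_cases i <;> simp_all
    · have h : 2 ∈ L i ∧ 3 ∈ L i ∧ 0 ∉ L i ∧ 1 ∉ L i := by simp [hi]
      clear hi
      fin_cases i <;> simp_all
  · exact .inl ⟨not_exists.1 h02, not_exists.1 h13⟩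

end IsLabelling

/-! ### Closed walks that cover an orientation -/

/-- The cyclic sequence `f` runs through all vertices and all arcs of `D`, passing arcs in either
direction and possibly pausing at vertices. Pauses allow to treat shorter cycles as cycles of
length ten. -/
structure IsLazyCover (D : Digraph V) (f : Fin 10 → V) : Prop where
  surjective : Function.Surjective f
  step : ∀ i, f i = f (i + 1) ∨ D.Adj (f i) (f (i + 1)) ∨ D.Adj (f (i + 1)) (f i)
  arc : ∀ x y, D.Adj x y → ∃ i, (f i = x ∧ f (i + 1) = y) ∨ (f (i + 1) = x ∧ f i = y)

theorem IsLazyCover.rotate {D : Digraph V} {f : Fin 10 → V} (hf : IsLazyCover D f) (r : Fin 10) :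
    IsLazyCover D fun i => f (r + i) where
  surjective v := by
    obtain ⟨i, rfl⟩ := hf.surjective v
    exact ⟨i - r, by simp⟩
  step i := by simpa [add_assoc] using hf.step (r + i)
  arc x y h := by
    obtain ⟨i, hi⟩ := hf.arc x y h
    exact ⟨i - r, by simpa [← add_assoc] using hi⟩

theorem IsAcyclicOrientation.adj_iff {H : SimpleGraph W} {D : Digraph W}
    (hD : IsAcyclicOrientation H D) {x y : W} : H.Adj x y ↔ D.Adj x y ∨ D.Adj y x := by
  rw [← hD.2]
  refine ⟨fun h => h.2, fun h => ⟨?_, h⟩⟩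
  rintro rfl
  exact hD.1 x (.single (h.elim id id))

theorem IsAcyclicOrientation.not_adj_sources {H : SimpleGraph W} {D : Digraph W}
    (hD : IsAcyclicOrientation H D) {x y : W} (hx : x ∈ sources D) (hy : y ∈ sources D) :
    ¬ H.Adj x y := by
  rw [hD.adj_iff]
  rintro (h | h)
  exacts [hy _ h, hx _ h]

/-- A cyclic sequence of length ten that runs through the cycle of length `n`, possibly with pauses,
turns a spasm of this cycle into a lazy cover. -/
theorem IsAcyclicOrientation.isLazyCover {n : ℕ} {H : SimpleGraph W} {D : Digraph W}
    (hD : IsAcyclicOrientation H D) (f : SimpleGraph.cycleGraph n →g H)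
    (hf : Function.Surjective f)
    (hf' : ∀ a b : W, H.Adj a b → ∃ x y, (SimpleGraph.cycleGraph n).Adj x y ∧ f x = a ∧ f y = b)
    (p : Fin 10 → Fin n) (hp : Function.Surjective p)
    (hstep : ∀ i, p i = p (i + 1) ∨ (SimpleGraph.cycleGraph n).Adj (p i) (p (i + 1)))
    (hadj : ∀ x y, (SimpleGraph.cycleGraph n).Adj x y →
      ∃ i, (p i = x ∧ p (i + 1) = y) ∨ (p (i + 1) = x ∧ p i = y)) :
    IsLazyCover D (f ∘ p) where
  surjective := hf.comp hp
  step i := (hstep i).imp (congrArg f) fun h => hD.adj_iff.1 (f.map_adj h)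
  arc a b h := by
    obtain ⟨x, y, hxy, rfl, rfl⟩ := hf' a b (hD.adj_iff.2 (.inl h))
    obtain ⟨i, ⟨rfl, rfl⟩ | ⟨rfl, rfl⟩⟩ := hadj x y hxy
    exacts [⟨i, .inl ⟨rfl, rfl⟩⟩, ⟨i, .inr ⟨rfl, rfl⟩⟩]

/-- A path from the source `s x` to a vertex that is also reached from other sources contains an arc
at which the set of sources reaching the current vertex first exceeds `{s x}`. -/
theorem exists_arc_of_reaches {ι : Type*} {D : Digraph V} {s : ι → V}
    (hs : Function.Injective s) (hsrc : ∀ i, s i ∈ sources D) {x : ι} {v : V}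
    (hx : Reaches D (s x) v) (hne : {i | Reaches D (s i) v} ≠ {x}) :
    ∃ u w, D.Adj u w ∧ {i | Reaches D (s i) u} = {x} ∧ Reaches D (s x) w ∧
      {i | Reaches D (s i) w} ≠ {x} ∧ Reaches D w v := by
  induction hx with
  | refl =>
    refine absurd ?_ hne
    ext i
    exact ⟨fun h => hs (Reaches.eq_of_mem_sources h (hsrc x)), fun h => h ▸ .refl⟩
  | @tail u w hu huw ih =>
    by_cases h : {i | Reaches D (s i) u} = {x}
    · exact ⟨u, w, huw, h, hu.tail huw, hne, .refl⟩
    · obtain ⟨u', w', h₁, h₂, h₃, h₄, h₅⟩ := ih h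
      exact ⟨u', w', h₁, h₂, h₃, h₄, h₅.tail huw⟩

theorem IsLazyCover.isLabelling [Finite V] {D : Digraph V} (hD : IsAcyclic D) {f : Fin 10 → V}
    (hf : IsLazyCover D f) {s : Fin 4 → V} (hs : Function.Injective s)
    (hsrc : sources D = Set.range s) :
    IsLabelling fun i => {x | Reaches D (s x) (f i)} where
  nonempty i := by
    obtain ⟨a, ha, h⟩ := hD.exists_source_reaches (f i)
    rw [hsrc] at ha
    obtain ⟨x, rfl⟩ := ha
    exact ⟨x, h⟩
  comparable i := by
    rcases hf.step i with h | h | h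
    · exact .inl fun x hx => show Reaches D _ _ from h ▸ hx
    · exact .inl fun x hx => Relation.ReflTransGen.tail hx h
    · exact .inr fun x hx => Relation.ReflTransGen.tail hx h
  entry i x hx hne := by
    obtain ⟨u, w, h₁, h₂, h₃, h₄, h₅⟩ :=
      exists_arc_of_reaches hs (fun i => hsrc ▸ Set.mem_range_self i) hx hne
    obtain ⟨j, ⟨rfl, rfl⟩ | ⟨rfl, rfl⟩⟩ := hf.arc u w h₁
    · exact ⟨j, .inl ⟨h₂, h₃, h₄, fun y hy => Relation.ReflTransGen.trans hy h₅⟩⟩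
    · exact ⟨j, .inr ⟨h₂, h₃, h₄, fun y hy => Relation.ReflTransGen.trans hy h₅⟩⟩

/-! ### Four sources -/

/-- Four pairwise non-adjacent positions on a cycle of length ten, up to rotation. -/
theorem exists_rotation_of_card_eq_four {S : Finset (Fin 10)} (hS : S.card = 4)
    (hadj : ∀ i ∈ S, i + 1 ∉ S) : ∃ (r : Fin 10) (q : Fin 4 → Fin 10),
      (q = ![0, 4, 6, 8] ∨ q = ![0, 3, 6, 8] ∨ q = ![0, 3, 5, 8]) ∧
        ∀ y, y ∈ S ↔ ∃ x, r + q x = y := by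
  have key : ∀ a b c d : Fin 10, a < b → b < c → c < d →
      a + 1 ≠ b → b + 1 ≠ c → c + 1 ≠ d → d + 1 ≠ a →
      ∃ q ∈ [![0, 4, 6, 8], ![0, 3, 6, 8], ![0, 3, 5, 8]], ∃ (r : Fin 10) (k : Fin 4),
        ∀ x, ![a, b, c, d] (x + k) = r + q x := by
    decide +kernel
  let e := S.orderEmbOfFin hS
  have he : ∀ y, y ∈ S ↔ ∃ x, e x = y := fun y => by
    rw [← Finset.mem_coe, ← S.range_orderEmbOfFin hS, Set.mem_range]
  have hne : ∀ i j, e i + 1 ≠ e j := fun i j h => hadj _ ((he _).2 ⟨i, rfl⟩) ((he _).2 ⟨j, h.symm⟩)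
  have hlt : ∀ i j, i < j → e i < e j := fun i j h => e.strictMono h
  obtain ⟨q, hq, r, k, h⟩ := key (e 0) (e 1) (e 2) (e 3) (hlt _ _ (by decide))
    (hlt _ _ (by decide)) (hlt _ _ (by decide)) (hne _ _) (hne _ _) (hne _ _) (hne _ _)
  have hvec : ![e 0, e 1, e 2, e 3] = e := by
    ext x
    fin_cases x <;> rfl
  rw [hvec] at h
  refine ⟨r, q, by simpa using hq, fun y => ?_⟩
  rw [he]
  constructor
  · rintro ⟨x, rfl⟩
    exact ⟨x - k, by rw [← h, sub_add_cancel]⟩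
  · rintro ⟨x, rfl⟩
    exact ⟨x + k, h x⟩

theorem exists_rotation_of_card_eq_five {S : Finset (Fin 10)} (hS : S.card = 5)
    (hadj : ∀ i ∈ S, i + 1 ∉ S) : ∃ r : Fin 10, ∀ y, y ∈ S ↔ ∃ x, r + ![0, 2, 4, 6, 8] x = y := by
  have key : ∀ a b c d e : Fin 10, a < b → b < c → c < d → d < e →
      a + 1 ≠ b → b + 1 ≠ c → c + 1 ≠ d → d + 1 ≠ e → e + 1 ≠ a →
      ∀ x, ![a, b, c, d, e] x = a + ![0, 2, 4, 6, 8] x := by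
    decide +kernel
  let e := S.orderEmbOfFin hS
  have he : ∀ y, y ∈ S ↔ ∃ x, e x = y := fun y => by
    rw [← Finset.mem_coe, ← S.range_orderEmbOfFin hS, Set.mem_range]
  have hne : ∀ i j, e i + 1 ≠ e j := fun i j h => hadj _ ((he _).2 ⟨i, rfl⟩) ((he _).2 ⟨j, h.symm⟩)
  have hlt : ∀ i j, i < j → e i < e j := fun i j h => e.strictMono h
  have h := key (e 0) (e 1) (e 2) (e 3) (e 4) (hlt _ _ (by decide))
    (hlt _ _ (by decide)) (hlt _ _ (by decide)) (hlt _ _ (by decide)) (hne _ _) (hne _ _)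
    (hne _ _) (hne _ _) (hne _ _)
  have hvec : ![e 0, e 1, e 2, e 3, e 4] = e := by
    ext x
    fin_cases x <;> rfl
  rw [hvec] at h
  exact ⟨e 0, fun y => (he y).trans (exists_congr fun x => by rw [h])⟩

/-- A choice of one position for each source. Sources are pairwise non-adjacent, so no two of the
chosen positions are consecutive. -/
theorem IsLazyCover.exists_positions {D : Digraph V} {f : Fin 10 → V} (hf : IsLazyCover D f) :
    ∃ S : Finset (Fin 10), S.card = (sources D).ncard ∧ f '' S = sources D ∧
      Set.InjOn f S ∧ ∀ i ∈ S, i + 1 ∉ S := by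
  classical
  obtain ⟨S, -, hinj, himg⟩ : ∃ S : Set (Fin 10), S ⊆ Set.univ ∧ Set.InjOn f S ∧
      f '' S = sources D := by
    obtain ⟨S, hS, h⟩ := Set.SurjOn.exists_bijOn_subset
      (f := f) (s := Set.univ) (t := sources D) fun x _ => by
        obtain ⟨i, rfl⟩ := hf.surjective x
        exact ⟨i, trivial, rfl⟩
    exact ⟨S, hS, h.injOn, h.image_eq⟩
  have hadj : ∀ i ∈ S, i + 1 ∉ S := by
    intro i hi hi'
    have h₁ : f i ∈ sources D := himg ▸ ⟨i, hi, rfl⟩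
    have h₂ : f (i + 1) ∈ sources D := himg ▸ ⟨_, hi', rfl⟩
    rcases hf.step i with h | h | h
    · have : i = i + 1 := hinj hi hi' h
      simp at this
    · exact h₂ _ h
    · exact h₁ _ h
  refine ⟨S.toFinset, ?_, by simpa using himg, by simpa using hinj, by simpa using hadj⟩
  rw [← himg, hinj.ncard_image, Set.ncard_eq_toFinset_card']

/-- A cyclic order of four sources without an occurring diagonal gives a cycle of length four, and
a dominated source gives one of length three. -/
theorem isCycleReducible_of_labelling {D : Digraph V}
    (hD : IsAcyclic D) (hconn : D.toSimpleGraphInclusive.Connected) {s : Fin 4 → V}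
    (hs : Function.Injective s) (hsrc : sources D = Set.range s)
    {f : Fin 10 → V} (hf : Function.Surjective f) {L : Fin 10 → Set (Fin 4)}
    (hL : ∀ i, L i = {x | Reaches D (s x) (f i)})
    (h : ((∀ i, L i ≠ {0, 2}) ∧ ∀ i, L i ≠ {1, 3}) ∨
      ((∀ i, L i ≠ {0, 1}) ∧ ∀ i, L i ≠ {2, 3}) ∨
      ∃ x y, x ≠ y ∧ ∀ i, x ∈ L i → L i ≠ {x} → y ∈ L i) :
    ∃ l : ℕ, l ≤ 4 ∧ IsCycleReducible l D := by
  rcases h with ⟨h₁, h₂⟩ | ⟨h₁, h₂⟩ | ⟨x, y, hxy, h⟩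
  · refine ⟨4, le_rfl, isCycleReducible_four hD hconn hs hsrc ?_ ?_⟩
    · intro v
      obtain ⟨i, rfl⟩ := hf v
      exact hL i ▸ h₁ i
    · intro v
      obtain ⟨i, rfl⟩ := hf v
      exact hL i ▸ h₂ i
  · -- The cyclic order `1, 2, 0, 3` has the diagonals `{0, 1}` and `{2, 3}`.
    let σ : Equiv.Perm (Fin 4) := ⟨![1, 2, 0, 3], ![2, 0, 1, 3], by decide, by decide⟩
    have hne : ∀ v {a b : Fin 4}, (∀ i, L i ≠ {σ a, σ b}) →
        {x | Reaches D ((s ∘ σ) x) v} ≠ {a, b} := by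
      intro v a b hab he
      obtain ⟨i, rfl⟩ := hf v
      refine hab i ?_
      rw [← Set.image_pair, ← he, hL]
      exact (Set.image_preimage_eq _ σ.surjective).symm
    exact ⟨4, le_rfl, isCycleReducible_four hD hconn (hs.comp σ.injective)
      (by rw [hsrc, σ.surjective.range_comp])
      (fun v => hne v fun i => by rw [Set.pair_comm]; exact h₁ i) (fun v => hne v h₂)⟩
  · obtain ⟨p, q, hpq, hpy, hpx, hqy, hqx, hall⟩ : ∃ p q : Fin 4, p ≠ q ∧ p ≠ y ∧ p ≠ x ∧ q ≠ y ∧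
        q ≠ x ∧ ∀ z, z = p ∨ z = q ∨ z = y ∨ z = x := by
      clear h
      revert x y
      decide
    refine ⟨3, by norm_num, isCycleReducible_three hD hconn (a := s p) (b := s q) (c := s y)
      (d := s x) ?_ (hs.ne hpq) (hs.ne hpy) (hs.ne hqy) (hs.ne hpx) (hs.ne hqx) ?_⟩
    · rw [hsrc]
      ext z
      constructor
      · rintro ⟨w, rfl⟩
        rcases hall w with rfl | rfl | rfl | rfl <;> simp
      · rintro (rfl | rfl | rfl | rfl) <;> exact Set.mem_range_self _
    · intro v hv hv'
      obtain ⟨i, rfl⟩ := hf v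
      have := h i (by rw [hL]; exact hv) ?_
      · rw [hL] at this
        exact this
      · rw [hL]
        intro he
        rcases hv' with h' | h'
        · exact hpx (he ▸ h' : p ∈ ({x} : Set (Fin 4)))
        · exact hqx (he ▸ h' : q ∈ ({x} : Set (Fin 4)))

theorem IsLazyCover.exists_isCycleReducible_of_ncard_eq_four [Finite V] {D : Digraph V}
    (hD : IsAcyclic D) (hconn : D.toSimpleGraphInclusive.Connected) {f : Fin 10 → V}
    (hf : IsLazyCover D f) (hcard : (sources D).ncard = 4) :
    ∃ l : ℕ, l ≤ 4 ∧ IsCycleReducible l D := by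
  obtain ⟨S, hS, himg, hinj, hadj⟩ := hf.exists_positions
  rw [hcard] at hS
  obtain ⟨r, q, hq, hSq⟩ := exists_rotation_of_card_eq_four hS hadj
  have hq_inj : Function.Injective q := by
    rcases hq with rfl | rfl | rfl <;> decide
  have hs : Function.Injective fun x => f (r + q x) := fun x y h =>
    hq_inj (add_left_cancel (hinj ((hSq _).2 ⟨x, rfl⟩) ((hSq _).2 ⟨y, rfl⟩) h))
  have hsrc : sources D = Set.range fun x => f (r + q x) := by
    rw [← himg]
    ext v
    simp [hSq]
  have hL := (hf.rotate r).isLabelling hD hs hsrc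
  have hLq : ∀ x, {y | Reaches D (f (r + q y)) (f (r + q x))} = {x} := by
    intro x
    ext y
    refine ⟨fun h => hs (Reaches.eq_of_mem_sources h ?_), fun h => h ▸ .refl⟩
    rw [hsrc]
    exact ⟨x, rfl⟩
  refine isCycleReducible_of_labelling hD hconn hs hsrc (hf.rotate r).surjective
    (fun i => rfl) ?_
  rcases hq with rfl | rfl | rfl
  · exact (hL.cases_four_two_two_two (hLq 0) (hLq 1) (hLq 2) (hLq 3)).imp id .inr
  · exact (hL.cases_three_three_two_two (hLq 0) (hLq 1) (hLq 2) (hLq 3)).imp id .inr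
  · exact (hL.cases_three_two_three_two (hLq 0) (hLq 1) (hLq 2) (hLq 3)).imp id .inl

/-! ### Five sources -/

/-- A cycle of length ten with five sources alternates between sources and other vertices. So each
out-neighbour of a source is also an out-neighbour of a source next to it in the cyclic order. -/
theorem IsAcyclicOrientation.isCycleReducible_of_ncard_eq_five {H : SimpleGraph W} {D : Digraph W}
    (hD : IsAcyclicOrientation H D) (hconn : D.toSimpleGraphInclusive.Connected)
    (f : SimpleGraph.cycleGraph 10 →g H) (hf : IsLazyCover D f) (hcard : (sources D).ncard = 5) :
    IsCycleReducible 5 D := by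
  obtain ⟨S, hS, himg, hinj, hadj⟩ := hf.exists_positions
  rw [hcard] at hS
  obtain ⟨r, hSq⟩ := exists_rotation_of_card_eq_five hS hadj
  have hcyc : ∀ i, (SimpleGraph.cycleGraph 10).Adj i (i + 1) := by decide
  obtain ⟨q, hq⟩ : ∃ q : ZMod 5 → Fin 10, q = ![0, 2, 4, 6, 8] := ⟨_, rfl⟩
  replace hSq : ∀ y, y ∈ S ↔ ∃ x, r + q x = y := by rw [hq]; exact hSq
  have hq_inj : Function.Injective q := by
    have h : Function.Injective (![0, 2, 4, 6, 8] : Fin 5 → Fin 10) := by decide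
    rw [hq]
    exact h
  have hq_succ : ∀ i, q (i + 1) = q i + 1 + 1 := by rw [hq]; decide
  have hq_cover : ∀ z, ∃ x, q x = z ∨ q x + 1 = z := by
    have h : ∀ z : Fin 10, ∃ x : Fin 5,
        ![0, 2, 4, 6, 8] x = z ∨ ![0, 2, 4, 6, 8] x + 1 = z := by decide
    rw [hq]
    exact h
  have hmem : ∀ i, r + q i ∈ S := fun i => (hSq _).2 ⟨i, rfl⟩
  let s : ZMod 5 → W := fun i => f (r + q i)
  have hs_inj : Function.Injective s := fun x y h =>
    hq_inj (add_left_cancel (hinj (hmem x) (hmem y) h))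
  have hsrc : ∀ x, x ∈ sources D ↔ ∃ i, x = s i := by
    intro x
    rw [← himg]
    simp [hSq, s, eq_comm]
  have hs : ∀ i, s i ∈ sources D := fun i => (hsrc _).2 ⟨i, rfl⟩
  -- Each source occurs only at its chosen position: the other positions are next to a source.
  have hpos : ∀ k i, f k = s i → k = r + q i := by
    intro k i hk
    obtain ⟨x, hx⟩ := hq_cover (k - r)
    rcases hx with hx | hx
    · obtain rfl : k = r + q x := by rw [hx]; abel
      exact congrArg (r + q ·) (hs_inj hk)
    · obtain rfl : k = r + q x + 1 := by rw [add_assoc, hx]; abel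
      refine absurd (f.map_adj (hcyc (r + q x))) (hD.not_adj_sources (hs x) ?_)
      exact hk ▸ hs i
  refine isCycleReducible_of_dominated (by norm_num) le_rfl hD.1 hconn s s (by simpa using hsrc)
    (fun i j hij => ⟨hs_inj.ne hij, hs_inj.ne hij, hs_inj.ne hij⟩) (fun _ _ _ _ h _ => h) ?_
  intro v i hi j hj hij
  rcases Relation.ReflTransGen.cases_head hi with rfl | ⟨w, hw, hwv⟩
  · exact absurd (hs_inj (Reaches.eq_of_mem_sources hj (hs i))) hij
  have hreach : ∀ m, H.Adj (s m) w → Reaches D (s m) v := fun m h =>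
    .head ((hD.adj_iff.1 h).resolve_right (hs m w)) hwv
  obtain ⟨k, ⟨h₁, rfl⟩ | ⟨h₁, rfl⟩⟩ := hf.arc _ _ hw
  · refine .inr (hreach _ (f.map_adj ?_).symm)
    rw [hpos k i h₁, hq_succ, ← add_assoc, ← add_assoc]
    exact hcyc _
  · refine .inl (hreach _ (f.map_adj ?_))
    have hk := hpos _ i h₁
    rw [← sub_add_cancel i 1, hq_succ, ← add_assoc, add_left_inj] at hk
    rw [hk, ← add_assoc]
    exact hcyc _

/-! ### Spasms of cycles -/

/-- Sources are pairwise non-adjacent, so a closed walk of length `n` meets at most `n / 2` of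
them. -/
theorem IsAcyclicOrientation.two_mul_ncard_sources_le {n : ℕ} [NeZero n] {H : SimpleGraph W}
    {D : Digraph W} (hD : IsAcyclicOrientation H D)
    (hn : ∀ i, (SimpleGraph.cycleGraph n).Adj i (i + 1))
    (f : SimpleGraph.cycleGraph n →g H) (hf : Function.Surjective f) :
    2 * (sources D).ncard ≤ n := by
  obtain ⟨g, hg⟩ := hf.hasRightInverse
  have hne : ∀ x y : sources D, g x + 1 ≠ g y := fun x y h =>
    hD.not_adj_sources x.2 y.2 (by
      have := f.map_adj (hn (g x))
      rwa [h, hg, hg] at this)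
  let p : sources D ⊕ sources D → Fin n := Sum.elim (fun x => g x) (fun x => g x + 1)
  have hp : Function.Injective p := by
    have hg' : Function.Injective fun x : sources D => g x :=
      hg.injective.comp Subtype.val_injective
    refine hg'.sumElim ((add_left_injective _).comp hg') ?_
    exact fun x y h => hne y x h.symm
  have : Finite W := Finite.of_surjective f hf
  have h := Nat.card_le_card_of_injective p hp
  rw [Nat.card_sum, Nat.card_coe_set_eq, Nat.card_fin] at h
  omega

theorem IsAcyclicOrientation.connected {n : ℕ} [NeZero n] {H : SimpleGraph W}
    {D : Digraph W} (hD : IsAcyclicOrientation H D)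
    (f : SimpleGraph.cycleGraph n →g H) (hf : Function.Surjective f) :
    D.toSimpleGraphInclusive.Connected := by
  obtain ⟨m, rfl⟩ := Nat.exists_eq_succ_of_ne_zero (NeZero.ne n)
  rw [hD.2]
  exact SimpleGraph.Connected.map f hf SimpleGraph.cycleGraph_connected

theorem dagTreewidth_eq_one_or_isCycleReducible_three [Finite V] {D : Digraph V}
    (hD : IsAcyclic D) (hconn : D.toSimpleGraphInclusive.Connected)
    (h : (sources D).ncard ≤ 3) : dagTreewidth D = 1 ∨ IsCycleReducible 3 D := by
  have hpos : 0 < (sources D).ncard := by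
    obtain ⟨v⟩ := hconn.nonempty
    obtain ⟨a, ha, -⟩ := hD.exists_source_reaches v
    exact (Set.ncard_pos).2 ⟨a, ha⟩
  obtain h | h | h : (sources D).ncard = 1 ∨ (sources D).ncard = 2 ∨ (sources D).ncard = 3 := by
    omega
  · obtain ⟨a, ha⟩ := Set.ncard_eq_one.1 h
    exact .inl (dagTreewidth_eq_one_of_sources_eq_pair D (ha.trans (Set.pair_eq_singleton a).symm))
  · obtain ⟨a, b, -, hab⟩ := Set.ncard_eq_two.1 h
    exact .inl (dagTreewidth_eq_one_of_sources_eq_pair D hab)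
  · obtain ⟨a, b, c, hab, hac, hbc, habc⟩ := Set.ncard_eq_three.1 h
    exact .inr (isCycleReducible_three hD hconn (d := c)
      (by rw [habc, Set.pair_eq_singleton]) hab hac hbc hac hbc fun _ h _ => h)

theorem InSpasm.isCycleComputable_three {n : ℕ} [NeZero n] {H : SimpleGraph W}
    (hn : ∀ i, (SimpleGraph.cycleGraph n).Adj i (i + 1)) (hn' : n < 8)
    (h : InSpasm (SimpleGraph.cycleGraph n) H) : IsCycleComputable 3 H := by
  obtain ⟨f, hf, -⟩ := h
  intro D hD
  have : Finite W := Finite.of_surjective f hf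
  have hcard := hD.two_mul_ncard_sources_le hn f hf
  exact (dagTreewidth_eq_one_or_isCycleReducible_three hD.1 (hD.connected f hf) (by omega)).imp id
    fun h => ⟨3, le_rfl, h⟩

theorem InSpasm.isCycleComputable_four {n : ℕ} [NeZero n] {H : SimpleGraph W}
    (hn : ∀ i, (SimpleGraph.cycleGraph n).Adj i (i + 1)) (hn' : n < 10)
    (p : Fin 10 → Fin n) (hp : Function.Surjective p)
    (hstep : ∀ i, p i = p (i + 1) ∨ (SimpleGraph.cycleGraph n).Adj (p i) (p (i + 1)))
    (hadj : ∀ x y, (SimpleGraph.cycleGraph n).Adj x y →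
      ∃ i, (p i = x ∧ p (i + 1) = y) ∨ (p (i + 1) = x ∧ p i = y))
    (h : InSpasm (SimpleGraph.cycleGraph n) H) : IsCycleComputable 4 H := by
  obtain ⟨f, hf, hf'⟩ := h
  intro D hD
  have : Finite W := Finite.of_surjective f hf
  have hcard := hD.two_mul_ncard_sources_le hn f hf
  have hconn := hD.connected f hf
  rcases Nat.lt_or_ge (sources D).ncard 4 with h | h
  · exact (dagTreewidth_eq_one_or_isCycleReducible_three hD.1 hconn (by omega)).imp id
      fun h => ⟨3, by norm_num, h⟩
  · exact .inr ((hD.isLazyCover f hf hf' p hp hstep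
      hadj).exists_isCycleReducible_of_ncard_eq_four hD.1 hconn (by omega))

theorem InSpasm.isCycleComputable_five {H : SimpleGraph W}
    (h : InSpasm (SimpleGraph.cycleGraph 10) H) : IsCycleComputable 5 H := by
  obtain ⟨f, hf, hf'⟩ := h
  intro D hD
  have : Finite W := Finite.of_surjective f hf
  have hcard := hD.two_mul_ncard_sources_le (by decide) f hf
  have hconn := hD.connected f hf
  have hcover : IsLazyCover D f := hD.isLazyCover f hf hf' id Function.surjective_id
    (by decide) (by decide)
  rcases Nat.lt_or_ge (sources D).ncard 4 with h | h
  · exact (dagTreewidth_eq_one_or_isCycleReducible_three hD.1 hconn (by omega)).imp id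
      fun h => ⟨3, by norm_num, h⟩
  · obtain h | h : (sources D).ncard = 4 ∨ (sources D).ncard = 5 := by omega
    · obtain ⟨l, hl, h⟩ := hcover.exists_isCycleReducible_of_ncard_eq_four hD.1 hconn h
      exact .inr ⟨l, by omega, h⟩
    · exact .inr ⟨5, le_rfl, hD.isCycleReducible_of_ncard_eq_five hconn f hcover h⟩

end CyclePatterns

theorem mainTheorem7 {W : Type*} (H : SimpleGraph W) :
    (CyclePatterns.InSpasm (SimpleGraph.cycleGraph 6) H → CyclePatterns.IsCycleComputable 3 H) ∧
    (CyclePatterns.InSpasm (SimpleGraph.cycleGraph 7) H → CyclePatterns.IsCycleComputable 3 H) ∧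
    (CyclePatterns.InSpasm (SimpleGraph.cycleGraph 8) H → CyclePatterns.IsCycleComputable 4 H) ∧
    (CyclePatterns.InSpasm (SimpleGraph.cycleGraph 9) H → CyclePatterns.IsCycleComputable 4 H) ∧
    (CyclePatterns.InSpasm (SimpleGraph.cycleGraph 10) H →
      CyclePatterns.IsCycleComputable 5 H) := by
  refine ⟨fun h => h.isCycleComputable_three (by decide) (by norm_num),
    fun h => h.isCycleComputable_three (by decide) (by norm_num), fun h => ?_, fun h => ?_,
    fun h => h.isCycleComputable_five⟩
  · exact h.isCycleComputable_four (by decide) (by norm_num) ![0, 1, 2, 3, 4, 5, 6, 7, 7, 7]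
      (by decide) (by decide) (by decide)
  · exact h.isCycleComputable_four (by decide) (by norm_num) ![0, 1, 2, 3, 4, 5, 6, 7, 8, 8]
      (by decide) (by decide) (by decide)
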